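/- Let $d\in\mathbb N$. There is a constant $C>0$, depending only on $d$, such that the following holds for every real $s>1$ and every finite set $P\subset\mathbb R^d$ of at least two points, with Euclidean distance $|pq|$. Let $G$ be any graph on $P$ produced by the uncoordinated construction with parameter $s$: start with no edges; the pairs $(p,q)$ of distinct points of $P$ are checked one after another, in an arbitrary order, until every $p\in P$ has checked every other $q\in P$; when $p$ checks $q$, the edge $pq$ is added to the current graph unless the current graph already has an edge $p'q'$ with $|pp'|\le \frac{|p'q'|}{2(s+1)}$ and $|qq'|\le \frac{|p'q'|}{2(s+1)}$ (edges are undirected, so either endpoint may play the role of $p'$). Let $|\mathrm{MST}|$ be the total edge length of a minimum spanning tree of $P$, and let $\alpha=\max_{u,v\in P}|uv|\,/\min_{u\ne v\in P}|uv|$ be the aspect ratio of $P$. Then the total edge length of $G$ is at most $$C\cdot\max(1,\lg\alpha)\cdot|\mathrm{MST}|\cdot s^{d+1},$$ where $\lg$ is the logarithm to base $2$. In particular, it is at most $C\cdot\lg\alpha\cdot|\mathrm{MST}|\cdot s^{d+1}$ whenever $\alpha\ge 2$. -/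

import Mathlib

namespace UncoordinatedSpanner

/-- The length of an (unordered) edge: the distance between its two endpoints. -/
noncomputable def edgeLength {V : Type*} [MetricSpace V] (e : Sym2 V) : ℝ :=
  Sym2.lift ⟨fun p q : V => dist p q, fun p q => dist_comm p q⟩ e

open Classical in
/-- The total weight of a graph on finitely many points: the sum of its edge lengths. -/
noncomputable def weight {V : Type*} [MetricSpace V] [Fintype V] (G : SimpleGraph V) : ℝ :=
  ∑ e ∈ G.edgeFinset, edgeLength e

/-- `T` is a minimum spanning tree of the complete graph on the points of `V`. -/
def IsMinimumSpanningTree {V : Type*} [MetricSpace V] [Fintype V] (T : SimpleGraph V) : Prop :=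
  T.IsTree ∧ ∀ T' : SimpleGraph V, T'.IsTree → weight T ≤ weight T'

/-- The aspect ratio of a point set: its maximum pairwise distance divided by the minimum
distance between two distinct points. -/
noncomputable def aspectRatio {E : Type*} [MetricSpace E] (S : Set E) : ℝ :=
  Metric.diam S / S.infsep

/-- When `p` looks at `q` while the current graph is `G`, the pair is already served: there is an
edge `p'q'` of `G` with `p`, `q` within distance `|p'q'| / (2(s+1))` of `p'`, `q'` respectively. -/
def Covered {V : Type*} [MetricSpace V] (s : ℝ) (G : SimpleGraph V) (p q : V) : Prop :=
  ∃ p' q' : V, G.Adj p' q' ∧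
    dist p p' ≤ dist p' q' / (2 * (s + 1)) ∧ dist q q' ≤ dist p' q' / (2 * (s + 1))

open Classical in
/-- One operation: the agent `x.1` checks the edge to `x.2`, and builds it unless it is covered. -/
noncomputable def check {V : Type*} [MetricSpace V] (s : ℝ) (G : SimpleGraph V) (x : V × V) :
    SimpleGraph V :=
  if Covered s G x.1 x.2 then G else G ⊔ SimpleGraph.edge x.1 x.2

/-- `G` is a possible outcome of the uncoordinated construction with parameter `s`: starting from
the graph without edges, the checks are performed one after the other in some arbitrary order,
until every agent has checked the edges from itself to all the other points. -/
def IsUncoordinatedSpanner {V : Type*} [MetricSpace V] (s : ℝ) (G : SimpleGraph V) : Prop :=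
  ∃ order : List (V × V),
    (∀ x ∈ order, x.1 ≠ x.2) ∧ (∀ p q : V, p ≠ q → (p, q) ∈ order) ∧
      G = order.foldl (check s) ⊥

end UncoordinatedSpanner

open Finset

namespace UncoordinatedSpanner

/-! Edge lengths lie between the least distance and the diameter, so about lg α dyadic scales
suffice and it is enough to bound each scale [L, 2L] by O(s^(d+1)) |MST|. Let r = L / (4(s+1)) and
round endpoints to a maximal r-separated net. Two distinct edges of this scale never round to the
same ordered pair, since the earlier one would have covered the later
(`IsUncoordinatedSpanner.not_close`). The first net point has O(s |MST| / L) choices, because a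
connected graph must pay about r near every net point (`card_mul_le_weight`); the second lies within
3L of it, leaving O(s^d) choices by volume (`card_le_of_separated`). Each edge costs at most 2L. -/

/-! ### Separation of long edges in the construction -/

theorem edgeLength_mk {V : Type*} [MetricSpace V] (p q : V) : edgeLength s(p, q) = dist p q := rfl

theorem edgeLength_nonneg {V : Type*} [MetricSpace V] (e : Sym2 V) : 0 ≤ edgeLength e := by
  induction e using Sym2.inductionOn with
  | hf p q => exact dist_nonneg

/-- If the later of two edges of length at least `L` is not covered by the earlier one, then the
two edges do not have both endpoints close. -/
theorem IsUncoordinatedSpanner.not_close {V : Type*} [MetricSpace V] {s L : ℝ} (hs : 0 < s + 1)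
    {G : SimpleGraph V} (hG : IsUncoordinatedSpanner s G) {p q p' q' : V}
    (h : G.Adj p q) (h' : G.Adj p' q') (hne : s(p, q) ≠ s(p', q'))
    (hL : L ≤ dist p q) (hL' : L ≤ dist p' q')
    (hp : dist p p' ≤ L / (2 * (s + 1))) (hq : dist q q' ≤ L / (2 * (s + 1))) : False := by
  obtain ⟨order, -, -, rfl⟩ := hG
  -- The claim is symmetric in the two edges, so it serves as an invariant of the construction
  -- without recording which edge came first.
  suffices H : ∀ (G₀ : SimpleGraph V),
      (∀ p q p' q' : V, G₀.Adj p q → G₀.Adj p' q' → s(p, q) ≠ s(p', q') →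
        L ≤ dist p q → L ≤ dist p' q' →
        dist p p' ≤ L / (2 * (s + 1)) → dist q q' ≤ L / (2 * (s + 1)) → False) →
      ∀ p q p' q' : V, (order.foldl (check s) G₀).Adj p q →
        (order.foldl (check s) G₀).Adj p' q' → s(p, q) ≠ s(p', q') →
        L ≤ dist p q → L ≤ dist p' q' →
        dist p p' ≤ L / (2 * (s + 1)) → dist q q' ≤ L / (2 * (s + 1)) → False from
    H ⊥ (by simp) p q p' q' h h' hne hL hL' hp hq
  clear h h' hne hL hL' hp hq p q p' q'
  induction order with
  | nil => exact fun _ h => h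
  | cons x order ih =>
    intro G₀ h₀
    refine ih _ ?_
    unfold check
    split_ifs with hc
    · exact h₀
    have key : ∀ p q p' q' : V, G₀.Adj p' q' → s(p, q) = s(x.1, x.2) → L ≤ dist p' q' →
        dist p p' ≤ L / (2 * (s + 1)) → dist q q' ≤ L / (2 * (s + 1)) → False := by
      intro p q p' q' h' he hL hp hq
      have hle : L / (2 * (s + 1)) ≤ dist p' q' / (2 * (s + 1)) := by gcongr
      rcases Sym2.eq_iff.1 he with ⟨rfl, rfl⟩ | ⟨rfl, rfl⟩
      · exact hc ⟨p', q', h', hp.trans hle, hq.trans hle⟩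
      · refine hc ⟨q', p', h'.symm, ?_, ?_⟩ <;> rw [dist_comm q' p']
        exacts [hq.trans hle, hp.trans hle]
    have adj : ∀ p q : V, (G₀ ⊔ SimpleGraph.edge x.1 x.2).Adj p q →
        G₀.Adj p q ∨ s(p, q) = s(x.1, x.2) := by
      intro p q h
      rw [SimpleGraph.sup_adj, SimpleGraph.edge_adj] at h
      rcases h with h | h
      · exact Or.inl h
      · exact Or.inr (Sym2.eq_iff.2 (by tauto))
    intro p q p' q' h h' hne hL hL' hp hq
    rcases adj p q h with h | h <;> rcases adj p' q' h' with h' | h'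
    · exact h₀ p q p' q' h h' hne hL hL' hp hq
    · exact key p' q' p q h h' hL (by rwa [dist_comm]) (by rwa [dist_comm])
    · exact key p q p' q' h' h hL' hp hq
    · exact hne (h.trans h'.symm)

/-! ### Lower bounds for the weight of a connected graph -/

/-- The variation of a real function along an unordered pair. -/
def edgeVariation {V : Type*} (f : V → ℝ) (e : Sym2 V) : ℝ :=
  Sym2.lift ⟨fun x y : V => |f x - f y|, fun x y => abs_sub_comm (f x) (f y)⟩ e

theorem edgeVariation_mk {V : Type*} (f : V → ℝ) (x y : V) :
    edgeVariation f s(x, y) = |f x - f y| := rfl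

theorem edgeVariation_nonneg {V : Type*} (f : V → ℝ) (e : Sym2 V) : 0 ≤ edgeVariation f e := by
  induction e using Sym2.inductionOn with
  | hf p q => exact abs_nonneg _

theorem abs_sub_le_sum_edgeVariation_walk {V : Type*} {T : SimpleGraph V} (f : V → ℝ) {u v : V}
    (w : T.Walk u v) : |f u - f v| ≤ (w.edges.map (edgeVariation f)).sum := by
  induction w with
  | nil => simp
  | cons h w ih =>
    rw [SimpleGraph.Walk.edges_cons, List.map_cons, List.sum_cons, edgeVariation_mk]
    exact (abs_sub_le _ _ _).trans (by gcongr)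

-- A path repeats no edge, so the variation along it is part of the sum over all edges.
open Classical in
theorem abs_sub_le_sum_edgeVariation {V : Type*} [Fintype V] {T : SimpleGraph V}
    (hT : T.Connected) (f : V → ℝ) (u v : V) :
    |f u - f v| ≤ ∑ e ∈ T.edgeFinset, edgeVariation f e := by
  obtain ⟨w, hw⟩ := (hT.preconnected u v).exists_isPath
  refine (abs_sub_le_sum_edgeVariation_walk f w).trans ?_
  rw [← List.sum_toFinset _ hw.isTrail.edges_nodup]
  refine sum_le_sum_of_subset_of_nonneg ?_ fun _ _ _ => edgeVariation_nonneg _ _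
  intro e he
  rw [SimpleGraph.mem_edgeFinset]
  exact w.edges_subset_edgeSet (List.mem_toFinset.1 he)

theorem dist_le_weight {V : Type*} [MetricSpace V] [Fintype V] {T : SimpleGraph V}
    (hT : T.Connected) (u v : V) : dist u v ≤ weight T := by
  classical
  have h := abs_sub_le_sum_edgeVariation hT (fun x => dist u x) v u
  rw [dist_self, sub_zero, abs_of_nonneg dist_nonneg] at h
  refine h.trans (le_of_le_of_eq (sum_le_sum fun e _ => ?_) (by unfold weight; congr))
  induction e using Sym2.inductionOn with
  | hf x y =>
    rw [edgeVariation_mk, edgeLength_mk, dist_comm u x, dist_comm u y]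
    exact abs_dist_sub_le x y u

/-- The tent of height `ρ` over `c`. -/
noncomputable def tent {V : Type*} [MetricSpace V] (ρ : ℝ) (c x : V) : ℝ := max 0 (ρ - dist c x)

theorem abs_tent_sub_le {V : Type*} [MetricSpace V] (ρ : ℝ) (c x y : V) :
    |tent ρ c x - tent ρ c y| ≤ dist x y := by
  unfold tent
  rw [max_comm 0, max_comm 0]
  refine (abs_max_sub_max_le_abs _ _ _).trans ?_
  rw [sub_sub_sub_cancel_left, dist_comm x y, dist_comm c y, dist_comm c x]
  exact abs_dist_sub_le y x c

/-- Tents over `2ρ`-separated points have disjoint supports, so that the sum of their variations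
along a pair is at most its length. -/
theorem sum_abs_tent_sub_le {V : Type*} [MetricSpace V] {ρ : ℝ} {N : Finset V}
    (hN : ∀ a ∈ N, ∀ b ∈ N, a ≠ b → 2 * ρ ≤ dist a b) (x y : V) :
    ∑ c ∈ N, |tent ρ c x - tent ρ c y| ≤ dist x y := by
  classical
  have unique : ∀ z : V, ∀ a ∈ N, ∀ b ∈ N, 0 < tent ρ a z → b ≠ a → tent ρ b z = 0 := by
    intro z a ha b hb hpos hne
    unfold tent at *
    have h1 : dist a z < ρ := by
      by_contra! h
      rw [max_eq_left (by linarith)] at hpos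
      exact lt_irrefl _ hpos
    have h2 := hN b hb a ha hne
    have h3 := dist_triangle_right b a z
    exact max_eq_left (by linarith)
  have nonneg : ∀ c z : V, 0 ≤ tent ρ c z := fun c z => le_max_left _ _
  by_cases hx : ∃ a ∈ N, 0 < tent ρ a x
  · obtain ⟨a, ha, hax⟩ := hx
    by_cases hy : ∃ b ∈ N, 0 < tent ρ b y
    · obtain ⟨b, hb, hby⟩ := hy
      by_cases hab : a = b
      · subst hab
        rw [sum_eq_single_of_mem a ha]
        · exact abs_tent_sub_le _ _ _ _
        · intro c hc hca
          rw [unique x a ha c hc hax hca, unique y a ha c hc hby hca, sub_zero, abs_zero]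
      -- With x and y under different tents, the sum is 2ρ - dist a x - dist b y, at most dist x y
      -- because dist a b ≥ 2ρ.
      · rw [← add_sum_erase N _ ha, ← add_sum_erase (N.erase a) _ (mem_erase.2 ⟨Ne.symm hab, hb⟩),
          sum_eq_zero, unique y b hb a ha hby hab, unique x a ha b hb hax (Ne.symm hab)]
        · rw [sub_zero, zero_sub, abs_neg, abs_of_pos hax, abs_of_pos hby]
          unfold tent at *
          rw [max_eq_right_of_lt (by simpa using hax), max_eq_right_of_lt (by simpa using hby)]
          have h1 := hN a ha b hb hab
          have h2 := dist_triangle4 a x y b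
          rw [dist_comm y b] at h2
          linarith
        · intro c hc
          simp only [mem_erase] at hc
          rw [unique x a ha c hc.2.2 hax hc.2.1, unique y b hb c hc.2.2 hby hc.1, sub_zero,
            abs_zero]
    · push Not at hy
      rw [sum_eq_single_of_mem a ha]
      · exact abs_tent_sub_le _ _ _ _
      · intro c hc hca
        rw [unique x a ha c hc hax hca, (hy c hc).antisymm (nonneg c y), sub_zero, abs_zero]
  · push Not at hx
    by_cases hy : ∃ b ∈ N, 0 < tent ρ b y
    · obtain ⟨b, hb, hby⟩ := hy
      rw [sum_eq_single_of_mem b hb]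
      · exact abs_tent_sub_le _ _ _ _
      · intro c hc hcb
        rw [unique y b hb c hc hby hcb, (hx c hc).antisymm (nonneg c x), sub_zero, abs_zero]
    · push Not at hy
      rw [sum_eq_zero]
      · exact dist_nonneg
      · intro c hc
        rw [(hx c hc).antisymm (nonneg c x), (hy c hc).antisymm (nonneg c y), sub_zero, abs_zero]

/-- A connected graph has weight at least `ρ` times the number of points of any `2ρ`-separated
set with at least two points. -/
theorem card_mul_le_weight {V : Type*} [MetricSpace V] [Fintype V] {T : SimpleGraph V}
    (hT : T.Connected) {ρ : ℝ} (hρ : 0 ≤ ρ) {N : Finset V} (h2 : 1 < #N)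
    (hN : ∀ a ∈ N, ∀ b ∈ N, a ≠ b → 2 * ρ ≤ dist a b) : #N * ρ ≤ weight T := by
  classical
  have h1 : ∀ c ∈ N, ρ ≤ ∑ e ∈ T.edgeFinset, edgeVariation (tent ρ c) e := by
    intro c hc
    -- The tent over c falls from ρ at c to 0 at any other point of N; hence the need for two
    -- points.
    obtain ⟨b, hb, hbc⟩ := exists_mem_ne h2 c
    refine le_trans ?_ (abs_sub_le_sum_edgeVariation hT (tent ρ c) c b)
    have h := hN c hc b hb hbc.symm
    unfold tent
    rw [dist_self, sub_zero, max_eq_right hρ, max_eq_left (by linarith), sub_zero]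
    exact le_abs_self ρ
  calc #N * ρ = ∑ _c ∈ N, ρ := by rw [sum_const, nsmul_eq_mul]
    _ ≤ ∑ c ∈ N, ∑ e ∈ T.edgeFinset, edgeVariation (tent ρ c) e := sum_le_sum h1
    _ = ∑ e ∈ T.edgeFinset, ∑ c ∈ N, edgeVariation (tent ρ c) e := sum_comm
    _ ≤ ∑ e ∈ T.edgeFinset, edgeLength e := by
      refine sum_le_sum fun e _ => ?_
      induction e using Sym2.inductionOn with
      | hf x y => exact sum_abs_tent_sub_le hN x y
    _ = weight T := by unfold weight; congr

/-! ### Packing and nets -/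

open MeasureTheory Metric Module in
/-- The volume bound for the number of `r`-separated points in a ball of radius `R`. -/
theorem card_le_of_separated {E : Type*} [NormedAddCommGroup E] [NormedSpace ℝ E]
    [FiniteDimensional ℝ E] {r R : ℝ} (hr : 0 < r) (hR : 0 ≤ R) (c : E) (N : Finset E)
    (hc : ∀ a ∈ N, dist a c ≤ R) (hN : ∀ a ∈ N, ∀ b ∈ N, a ≠ b → r ≤ dist a b) :
    (#N : ℝ) ≤ (1 + 2 * R / r) ^ finrank ℝ E := by
  borelize E
  let μ : Measure E := Measure.addHaar
  have δpos : 0 < r / 2 := by positivity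
  have ρpos : 0 < R + r / 2 := by positivity
  have D : Set.Pairwise (N : Set E) (Function.onFun Disjoint fun a => ball (a : E) (r / 2)) := by
    intro a ha b hb hab
    apply ball_disjoint_ball
    rw [add_halves]
    exact hN a ha b hb hab
  have A_subset : (⋃ a ∈ N, ball (a : E) (r / 2)) ⊆ ball c (R + r / 2) := by
    refine Set.iUnion₂_subset fun x hx => ball_subset_ball' ?_
    linarith [hc x hx]
  have I : (#N : ENNReal) * ENNReal.ofReal ((r / 2) ^ finrank ℝ E) * μ (ball 0 1) ≤
      ENNReal.ofReal ((R + r / 2) ^ finrank ℝ E) * μ (ball 0 1) :=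
    calc
      (#N : ENNReal) * ENNReal.ofReal ((r / 2) ^ finrank ℝ E) * μ (ball 0 1)
          = μ (⋃ a ∈ N, ball (a : E) (r / 2)) := by
        rw [measure_biUnion_finset D fun c _ => measurableSet_ball]
        simp only [μ.addHaar_ball_of_pos _ δpos]
        simp only [sum_const, nsmul_eq_mul, mul_assoc]
      _ ≤ μ (ball c (R + r / 2)) := measure_mono A_subset
      _ = ENNReal.ofReal ((R + r / 2) ^ finrank ℝ E) * μ (ball 0 1) := by
        simp only [μ.addHaar_ball_of_pos _ ρpos]
  have J := (ENNReal.mul_le_mul_iff_left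
    (measure_ball_pos μ (0 : E) zero_lt_one).ne' measure_ball_lt_top.ne).1 I
  have K := ENNReal.toReal_le_of_le_ofReal (pow_nonneg ρpos.le _) J
  rw [ENNReal.toReal_mul, ENNReal.toReal_natCast,
    ENNReal.toReal_ofReal (pow_nonneg δpos.le _), ← le_div_iff₀ (pow_pos δpos _), ← div_pow] at K
  refine K.trans_eq (congrArg (· ^ finrank ℝ E) ?_)
  field_simp
  ring

/-- Every finite set of points has an `r`-separated subset that is `r`-dense in it. -/
theorem exists_separated_dense (V : Type*) [MetricSpace V] [Fintype V] (r : ℝ) (hr : 0 ≤ r) :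
    ∃ N : Finset V, (∀ a ∈ N, ∀ b ∈ N, a ≠ b → r ≤ dist a b) ∧ ∀ x, ∃ a ∈ N, dist x a ≤ r := by
  classical
  obtain ⟨N, hN⟩ := (Set.toFinite
    {N : Finset V | ∀ a ∈ N, ∀ b ∈ N, a ≠ b → r ≤ dist a b}).exists_maximal ⟨∅, by simp⟩
  refine ⟨N, hN.prop, fun x => ?_⟩
  by_contra! hx
  have hmem : x ∉ N := fun h => absurd (hx x h) (by simpa using hr)
  have hins : insert x N ≤ N := by
    refine hN.le_of_ge ?_ (subset_insert x N)
    intro a ha b hb hab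
    rcases mem_insert.1 ha with rfl | ha' <;> rcases mem_insert.1 hb with rfl | hb'
    · exact absurd rfl hab
    · exact (hx b hb').le
    · rw [dist_comm]
      exact (hx a ha').le
    · exact hN.prop a ha' b hb' hab
  exact hmem (hins (mem_insert_self x N))

/-! ### A single length scale -/

/-- The edges whose length lies between `L` and `2L` have total length `O(s ^ (d + 1))` times the
weight of any connected graph. -/
theorem sum_edgeLength_le {d : ℕ} {s : ℝ} (hs : 1 < s) {P : Finset (EuclideanSpace ℝ (Fin d))}
    {G : SimpleGraph P} (hG : IsUncoordinatedSpanner s G) {T : SimpleGraph P} (hT : T.Connected)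
    {L : ℝ} (hL : 0 < L) (F : Finset (Sym2 P)) (hF : ∀ e ∈ F, e ∈ G.edgeSet)
    (hlow : ∀ e ∈ F, L ≤ edgeLength e) (hup : ∀ e ∈ F, edgeLength e ≤ 2 * L) :
    ∑ e ∈ F, edgeLength e ≤ 32 * 49 ^ d * weight T * s ^ (d + 1) := by
  classical
  rcases F.eq_empty_or_nonempty with rfl | ⟨e₀, he₀⟩
  · rw [sum_empty]
    have : 0 ≤ weight T := sum_nonneg fun e _ => edgeLength_nonneg e
    positivity
  have hs1 : 0 < s + 1 := by linarith
  -- Points with the same nearby net point are within 2r, exactly the covering threshold for an edge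
  -- of length L.
  set r := L / (4 * (s + 1)) with hr
  have hrpos : 0 < r := by positivity
  have h2r : r + r = L / (2 * (s + 1)) := by rw [hr]; field_simp; ring
  have hrL : 8 * r ≤ L := by
    rw [hr, mul_div_assoc', div_le_iff₀ (by positivity)]
    nlinarith
  obtain ⟨N, hsep, hdense⟩ := exists_separated_dense P r hrpos.le
  choose π hπN hπ using hdense
  have hM : L ≤ weight T := by
    refine (hlow e₀ he₀).trans ?_
    induction e₀ using Sym2.inductionOn with
    | hf x y => exact dist_le_weight hT x y
  have hcardN : (#N : ℝ) ≤ 16 * s * weight T / L := by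
    rw [le_div_iff₀ hL]
    rcases lt_or_ge 1 #N with h | h
    · have h1 := card_mul_le_weight hT (half_pos hrpos).le h
        (fun a ha b hb hab => by simpa [mul_div_cancel₀] using hsep a ha b hb hab)
      have h3 : L = r / 2 * (8 * (s + 1)) := by rw [hr]; field_simp; ring
      calc #N * L = #N * (r / 2) * (8 * (s + 1)) := by rw [mul_assoc, ← h3]
        _ ≤ weight T * (8 * (s + 1)) := by gcongr
        _ ≤ weight T * (16 * s) := by
          exact mul_le_mul_of_nonneg_left (by linarith) (hL.le.trans hM)
        _ = _ := by ring
    -- The tent bound needs two net points; for at most one, L ≤ weight T is enough.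
    · have h1 : (#N : ℝ) ≤ 1 := by exact_mod_cast h
      nlinarith
  -- The radius absorbs 2L + 2r, as 8r ≤ L.
  set B : P → Finset P := fun a => N.filter fun b => dist b a ≤ 3 * L with hB
  have hcardB : ∀ a, (#(B a) : ℝ) ≤ (49 * s) ^ d := by
    intro a
    have h1 := card_le_of_separated hrpos (by positivity : 0 ≤ 3 * L) (a : EuclideanSpace ℝ (Fin d))
      ((B a).map (Function.Embedding.subtype _))
      (by
        intro b hb
        obtain ⟨b, hb', rfl⟩ := mem_map.1 hb
        exact (mem_filter.1 hb').2)
      (by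
        intro b hb c hc hbc
        obtain ⟨b, hb', rfl⟩ := mem_map.1 hb
        obtain ⟨c, hc', rfl⟩ := mem_map.1 hc
        exact hsep b (mem_filter.1 hb').1 c (mem_filter.1 hc').1 (fun h => hbc (by rw [h])))
    rw [card_map, finrank_euclideanSpace_fin] at h1
    refine h1.trans ?_
    have h3 : 2 * (3 * L) / r = 24 * (s + 1) := by rw [hr]; field_simp; ring
    -- 1 + 24(s+1) = 24s + 25 ≤ 49s, as s > 1.
    rw [h3]
    gcongr
    linarith
  have hout : ∀ e : Sym2 P, s((Quot.out e).1, (Quot.out e).2) = e := fun e => Quot.out_eq e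
  have hcardF : #F ≤ #(N.sigma B) := by
    -- Arbitrary orientations from `Quot.out` suffice, since `not_close` applies to edges oriented
    -- either way.
    refine card_le_card_of_injOn (fun e => ⟨π (Quot.out e).1, π (Quot.out e).2⟩) ?_ ?_
    · intro e he
      have h1 := hup e he
      rw [← hout e, edgeLength_mk] at h1
      rw [mem_coe, mem_sigma]
      refine ⟨hπN _, mem_filter.2 ⟨hπN _, ?_⟩⟩
      have h3 := dist_triangle4 (π (Quot.out e).1) (Quot.out e).1 (Quot.out e).2 (π (Quot.out e).2)
      rw [dist_comm (π (Quot.out e).1) (Quot.out e).1] at h3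
      have h4 := hπ (Quot.out e).1
      have h5 := hπ (Quot.out e).2
      rw [dist_comm]
      dsimp only
      linarith
    · intro e he e' he' hee
      simp only [Sigma.mk.injEq, heq_eq_eq] at hee
      by_contra hne
      have hadj : ∀ e ∈ F, G.Adj (Quot.out e).1 (Quot.out e).2 := by
        intro e he
        rw [← SimpleGraph.mem_edgeSet, hout]
        exact hF e he
      have hlow' : ∀ e ∈ F, L ≤ dist (Quot.out e).1 (Quot.out e).2 := by
        intro e he
        rw [← edgeLength_mk, hout]
        exact hlow e he
      have hclose : ∀ x y, π x = π y → dist x y ≤ L / (2 * (s + 1)) := by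
        intro x y hxy
        rw [← h2r]
        refine (dist_triangle_right x y (π x)).trans (add_le_add (hπ x) ?_)
        rw [hxy]
        exact hπ y
      exact hG.not_close hs1 (hadj e he) (hadj e' he') (by rwa [hout, hout]) (hlow' e he)
        (hlow' e' he') (hclose _ _ hee.1) (hclose _ _ hee.2)
  have hcardF' : (#F : ℝ) ≤ 16 * s * weight T / L * (49 * s) ^ d := by
    calc (#F : ℝ) ≤ #(N.sigma B) := by exact_mod_cast hcardF
      _ = ∑ a ∈ N, (#(B a) : ℝ) := by rw [card_sigma, Nat.cast_sum]
      _ ≤ ∑ _a ∈ N, (49 * s) ^ d := sum_le_sum fun a _ => hcardB a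
      _ = #N * (49 * s) ^ d := by rw [sum_const, nsmul_eq_mul]
      _ ≤ _ := by gcongr
  calc ∑ e ∈ F, edgeLength e ≤ ∑ _e ∈ F, 2 * L := sum_le_sum hup
    _ = #F * (2 * L) := by rw [sum_const, nsmul_eq_mul]
    _ ≤ 16 * s * weight T / L * (49 * s) ^ d * (2 * L) := by gcongr
    _ = 32 * 49 ^ d * weight T * s ^ (d + 1) := by
      rw [mul_pow]
      field_simp
      ring

end UncoordinatedSpanner

/-! ### Summation over the dyadic scales -/

theorem mainTheorem4 (d : ℕ) :
    ∃ C : ℝ, 0 < C ∧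
      ∀ (s : ℝ), 1 < s →
      ∀ (P : Finset (EuclideanSpace ℝ (Fin d))), 2 ≤ P.card →
      ∀ (G : SimpleGraph P), UncoordinatedSpanner.IsUncoordinatedSpanner s G →
      ∀ (T : SimpleGraph P), UncoordinatedSpanner.IsMinimumSpanningTree T →
        UncoordinatedSpanner.weight G ≤
          C * max 1 (Real.logb 2 (UncoordinatedSpanner.aspectRatio
              (P : Set (EuclideanSpace ℝ (Fin d))))) *
            UncoordinatedSpanner.weight T * s ^ (d + 1) := by
  classical
  refine ⟨64 * 49 ^ d, by positivity, fun s hs P hP G hG T hT => ?_⟩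
  have hTc : T.Connected := hT.1.connected
  have hT0 : 0 ≤ UncoordinatedSpanner.weight T :=
    sum_nonneg fun e _ => UncoordinatedSpanner.edgeLength_nonneg e
  have hnt : (P : Set (EuclideanSpace ℝ (Fin d))).Nontrivial := by
    exact Finset.one_lt_card_iff_nontrivial.1 hP
  set m := (P : Set (EuclideanSpace ℝ (Fin d))).infsep with hm
  have hmpos : 0 < m := P.finite_toSet.infsep_pos_iff_nontrivial.2 hnt
  set α := UncoordinatedSpanner.aspectRatio (P : Set (EuclideanSpace ℝ (Fin d))) with hα
  have hlen : ∀ e ∈ G.edgeSet, 1 ≤ UncoordinatedSpanner.edgeLength e / m ∧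
      UncoordinatedSpanner.edgeLength e / m ≤ α := by
    intro e he
    induction e using Sym2.inductionOn with
    | hf x y =>
      rw [SimpleGraph.mem_edgeSet] at he
      rw [one_le_div hmpos, UncoordinatedSpanner.edgeLength_mk]
      refine ⟨Set.infsep_le_dist_of_mem x.2 y.2 (fun h => he.ne (Subtype.ext h)), ?_⟩
      exact div_le_div_of_nonneg_right
        (Metric.dist_le_diam_of_mem P.finite_toSet.isBounded x.2 y.2) hmpos.le
  set level : Sym2 P → ℕ := fun e => ⌊Real.logb 2 (UncoordinatedSpanner.edgeLength e / m)⌋₊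
    with hlevel
  set k := ⌊Real.logb 2 α⌋₊ with hk
  have hmaps : ∀ e ∈ G.edgeFinset, level e ∈ range (k + 1) := by
    intro e he
    obtain ⟨h1, h2⟩ := hlen e (SimpleGraph.mem_edgeFinset.1 he)
    rw [mem_range, Nat.lt_succ_iff]
    exact Nat.floor_le_floor (Real.logb_le_logb_of_le one_lt_two (by linarith) h2)
  have hsum : UncoordinatedSpanner.weight G ≤
      (k + 1) * (32 * 49 ^ d * UncoordinatedSpanner.weight T * s ^ (d + 1)) := by
    calc UncoordinatedSpanner.weight G
        = ∑ e ∈ G.edgeFinset, UncoordinatedSpanner.edgeLength e := by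
          unfold UncoordinatedSpanner.weight; congr
      _ = ∑ i ∈ range (k + 1), ∑ e ∈ G.edgeFinset with level e = i,
            UncoordinatedSpanner.edgeLength e := (sum_fiberwise_of_maps_to hmaps _).symm
      _ ≤ ∑ _i ∈ range (k + 1), 32 * 49 ^ d * UncoordinatedSpanner.weight T * s ^ (d + 1) := by
          refine sum_le_sum fun i _ => ?_
          have hmem : ∀ e ∈ G.edgeFinset.filter (level · = i), e ∈ G.edgeSet :=
            fun e he => SimpleGraph.mem_edgeFinset.1 (mem_filter.1 he).1
          refine UncoordinatedSpanner.sum_edgeLength_le hs hG hTc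
            (by positivity : 0 < 2 ^ i * m) _ hmem ?_ ?_
          · intro e he
            have h1 := (hlen e (hmem e he)).1
            rw [← le_div_iff₀ hmpos, ← Real.rpow_natCast, ← Real.le_logb_iff_rpow_le one_lt_two
              (by linarith), ← (mem_filter.1 he).2]
            -- The logarithm is nonnegative, so the natural floor does not truncate it.
            exact Nat.floor_le (Real.logb_nonneg one_lt_two h1)
          · intro e he
            have h1 := (hlen e (hmem e he)).1
            have h3 := (Nat.lt_floor_add_one
              (Real.logb 2 (UncoordinatedSpanner.edgeLength e / m))).le
            change _ ≤ (level e : ℝ) + 1 at h3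
            rw [(mem_filter.1 he).2, Real.logb_le_iff_le_rpow one_lt_two (by linarith),
              Real.rpow_add_one two_ne_zero, Real.rpow_natCast, div_le_iff₀ hmpos] at h3
            linarith
      _ = _ := by rw [sum_const, card_range, nsmul_eq_mul]; push_cast; ring
  -- This factor 2 turns the 32 of a single scale into the 64 of the constant.
  have hkα : (k : ℝ) + 1 ≤ 2 * max 1 (Real.logb 2 α) := by
    have h1 : (k : ℝ) ≤ max 1 (Real.logb 2 α) := by
      rcases le_total 0 (Real.logb 2 α) with h | h
      · exact (Nat.floor_le h).trans (le_max_right _ _)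
      · rw [hk, Nat.floor_of_nonpos h, Nat.cast_zero]
        exact zero_le_one.trans (le_max_left _ _)
    linarith [le_max_left 1 (Real.logb 2 α)]
  calc UncoordinatedSpanner.weight G
      ≤ (k + 1) * (32 * 49 ^ d * UncoordinatedSpanner.weight T * s ^ (d + 1)) := hsum
    _ ≤ 2 * max 1 (Real.logb 2 α) *
        (32 * 49 ^ d * UncoordinatedSpanner.weight T * s ^ (d + 1)) := by gcongr
    _ = _ := by ring
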